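/- Let $\varphi\colon[-1,1]\to\mathbb R$ be Lebesgue measurable and let $(\alpha_k)_{k\ge 0}$ be a sequence of positive reals with $\sum_{k}\alpha_k^{-1}<\infty$. Assume that $$0<\varphi_{\min}=\inf_{x\in[-1,1]}|\varphi(x)|\le \varphi_{\max}=\sup_{x\in[-1,1]}|\varphi(x)|<\infty$$ and that there is $\lambda>0$ with $$\frac{\alpha_k}{\alpha_n}\le \lambda^{n-k}\frac{k!}{n!}\qquad\text{for all } 0\le k\le n.$$ Let $H(K)$, with norm $\|\cdot\|_K$, be the reproducing kernel Hilbert space on $[-1,1]$ of the kernel $$K(x,y)=\varphi(x)\varphi(y)\sum_{k=0}^\infty \alpha_k^{-1}x^ky^k .$$ For pairwise distinct points $x_1,\dots,x_n\in[-1,1]$ and Lebesgue measurable functions $\psi_1,\dots,\psi_n\colon[-1,1]\to\mathbb R$ let $A_nf=\sum_{k=1}^n f(x_k)\psi_k$, and define $$e_\infty(A_n)=\sup_{0\ne f\in H(K)}\frac{\sup_{x\in[-1,1]}|f(x)-(A_nf)(x)|}{\|f\|_K}\in[0,\infty],\qquad e_\infty^{\min}(n)=\inf_{A_n}e_\infty(A_n),$$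 the infimum being over all $A_n$ of this form. Put $$c_L(\lambda)=\frac{e^{-\frac32\lambda+2\sqrt\lambda}}{2\sqrt\pi\,\lambda^{1/4}}\left(3+\sqrt{\frac{\pi}{e}}+\frac{2}{\sqrt\pi\,\lambda^{1/4}}+\frac{7}{16\sqrt\lambda}+\sqrt\lambda\,(2+\lambda)\right),\qquad m_L(\lambda)=\max\left\{5\lambda,\ \lambda\Big(1+\frac\lambda2\Big)^2,\ \frac9\lambda\right\}.$$ Then for every integer $n\ge m_L(\lambda)$, $$c_{1,\infty}\,2^{-n}\alpha_n^{-1/2}\ \le\ e_\infty^{\min}(n)\ \le\ c_{2,\infty}\,n^{-1/8}e^{\sqrt{\lambda n}}\,2^{-n}\alpha_n^{-1/2},$$ where $$c_{1,\infty}=\sqrt{\frac{2}{1+\lambda}}\;e^{-\lambda^2/32}\,\varphi_{\min},\qquad c_{2,\infty}=2\sqrt{c_L(\lambda)}\,\varphi_{\max}.$$ -/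

import Mathlib

open scoped ENNReal

noncomputable section

namespace WeightedPowerSeries

/-- The interval `[-1, 1]` as a type. -/
abbrev Dom : Type := Set.Icc (-1 : ℝ) 1

/-- Lebesgue measure on `[-1, 1]`. -/
def lebesgue : MeasureTheory.Measure Dom :=
  MeasureTheory.Measure.comap (fun x : Dom => (x : ℝ)) MeasureTheory.volume

/-- Lebesgue measurability of a real-valued function on `[-1, 1]`: preimages of Borel sets are
Lebesgue measurable, that is, measurable up to null sets. -/
def LebesgueMeasurable (f : Dom → ℝ) : Prop := MeasureTheory.NullMeasurable f lebesgue

/-- The weighted power series kernel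
`K(x, y) = φ(x) φ(y) ∑ₖ αₖ⁻¹ xᵏ yᵏ` on `[-1, 1] × [-1, 1]`. -/
def kernel (φ : Dom → ℝ) (α : ℕ → ℝ) (x y : Dom) : ℝ :=
  φ x * φ y * ∑' k : ℕ, (α k)⁻¹ * (x : ℝ) ^ k * (y : ℝ) ^ k

/-- `H` is the reproducing kernel Hilbert space of the real-valued kernel `K` on `[-1, 1]`.
The class `RKHS` makes `H` a space of functions on `[-1, 1]` with continuous point evaluations,
and `RKHS.kernel H x y` is its reproducing kernel, a linear map `ℝ → ℝ`, which is identified with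
its value at `1`. By the Moore–Aronszajn theorem `H` is determined by `K` up to an isometry
that preserves the underlying functions. -/
def IsRKHSOf (H : Type*) [NormedAddCommGroup H] [InnerProductSpace ℝ H] [CompleteSpace H]
    [RKHS ℝ H Dom ℝ] (K : Dom → Dom → ℝ) : Prop :=
  ∀ x y : Dom, RKHS.kernel H x y 1 = K x y

/-- The infimum of `|φ|` on `[-1, 1]`. -/
def phiMin (φ : Dom → ℝ) : ℝ := ⨅ x : Dom, |φ x|

/-- The supremum of `|φ|` on `[-1, 1]` (used only for bounded `φ`). -/
def phiMax (φ : Dom → ℝ) : ℝ := ⨆ x : Dom, |φ x|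

/-- The weight is bounded, and bounded away from zero. -/
def PhiAssumption (φ : Dom → ℝ) : Prop :=
  0 < phiMin φ ∧ BddAbove (Set.range fun x : Dom => |φ x|)

/-- The growth condition `α_k / α_n ≤ λ^(n-k) k! / n!` for all `0 ≤ k ≤ n`. -/
def AlphaAssumption (α : ℕ → ℝ) (lam : ℝ) : Prop :=
  ∀ n k : ℕ, k ≤ n →
    α k / α n ≤ lam ^ (n - k) * ((Nat.factorial k : ℝ) / (Nat.factorial n : ℝ))

/-- A linear approximation `A_n f = ∑_{k=1}^n f(x_k) ψ_k` with pairwise distinct points `x_k` of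
`[-1, 1]` and Lebesgue measurable real-valued functions `ψ_k` on `[-1, 1]`. -/
structure LinearApproximation (n : ℕ) where
  /-- The sampling points. -/
  node : Fin n → Dom
  node_injective : Function.Injective node
  /-- The functions `ψ_k`. -/
  weight : Fin n → Dom → ℝ
  measurable_weight : ∀ k, LebesgueMeasurable (weight k)

/-- The function `A_n f`. -/
def LinearApproximation.apply {n : ℕ} (A : LinearApproximation n) (f : Dom → ℝ) : Dom → ℝ :=
  fun x => ∑ k : Fin n, f (A.node k) * A.weight k x

/-- The (true, not essential) supremum of `|f|` over `[-1, 1]`, possibly infinite. -/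
def supNorm (f : Dom → ℝ) : ℝ≥0∞ := ⨆ x : Dom, ENNReal.ofReal |f x|

/-- The worst-case error
`e_∞(A_n) = sup { ‖f - A_n f‖_∞ / ‖f‖_H : 0 ≠ f ∈ H }`, possibly infinite. -/
def worstCaseError (H : Type*) [NormedAddCommGroup H] [InnerProductSpace ℝ H]
    [RKHS ℝ H Dom ℝ] {n : ℕ} (A : LinearApproximation n) : ℝ≥0∞ :=
  ⨆ (f : H) (_ : f ≠ 0),
    supNorm (fun x => f x - A.apply (fun y => f y) x) / ENNReal.ofReal ‖f‖

/-- The `n`th minimal worst-case error in the uniform norm. -/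
def minimalError (H : Type*) [NormedAddCommGroup H] [InnerProductSpace ℝ H]
    [RKHS ℝ H Dom ℝ] (n : ℕ) : ℝ≥0∞ :=
  ⨅ A : LinearApproximation n, worstCaseError H A

/-- The constant `c_L(λ)`. -/
def cL (lam : ℝ) : ℝ :=
  Real.exp (-(3 / 2) * lam + 2 * Real.sqrt lam) /
      (2 * Real.sqrt Real.pi * lam ^ (1 / 4 : ℝ)) *
    (3 + Real.sqrt (Real.pi / Real.exp 1) + 2 / (Real.sqrt Real.pi * lam ^ (1 / 4 : ℝ)) +
      7 / (16 * Real.sqrt lam) + Real.sqrt lam * (2 + lam))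

/-- The threshold `m_L(λ)`. -/
def mL (lam : ℝ) : ℝ :=
  max (5 * lam) (max (lam * (1 + lam / 2) ^ 2) (9 / lam))

/-- The constant `c_{1,∞}` of the lower bound. -/
def c1 (φ : Dom → ℝ) (lam : ℝ) : ℝ :=
  Real.sqrt (2 / (1 + lam)) * Real.exp (-(1 / 32) * lam ^ 2) * phiMin φ

/-- The constant `c_{2,∞}` of the upper bound. -/
def c2 (φ : Dom → ℝ) (lam : ℝ) : ℝ :=
  2 * Real.sqrt (cL lam) * phiMax φ

end WeightedPowerSeries

end

/-! By the reproducing property, f(x) - (A f)(x) is the inner product of f with `errorRepresenter`,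
so the worst-case error is the supremum over x of its norm. The square of that norm is the sum over
k of α_k⁻¹ times the squared error of A on the feature φ x^k (`hasSum_norm_errorRepresenter_sq`).
Both bounds thus become statements about monomials.

Upper bound: interpolate f/φ at the zeros of T_n and multiply back by φ. Degrees below n are
reproduced. Since x^k is a nonnegative combination of Chebyshev polynomials T_j, whose interpolation
errors are 0 for j < n and at most 2 otherwise, a Bernstein-ellipse estimate with free parameter r
follows (`abs_pow_sub_chebyshevInterp_le`). The growth condition gives α_{n+m}⁻¹ ≤ α_n⁻¹ (λ/n)^m,
and r² = 2n/λ turns the error series into a geometric one. The squared error is at most a constant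
times e^λ 4⁻ⁿ α_n⁻¹, which `cL_bound` compares with the stated expression.

Lower bound: let q be the monic polynomial vanishing at the nodes. Weighting the feature errors by
the coefficients q_k cancels every contribution of A and leaves φ(x) q(x). Cauchy–Schwarz bounds the
norm of the representer below by |φ(x) q(x)| / (∑ α_k q_k²)^{1/2}. With x a maximum point of |q|, it
remains to bound the weighted coefficient sum by the sup norm of q
(`sum_growthWeight_mul_coeff_sq_le`). This uses the Chebyshev expansion of q, Bessel's inequality
and the explicit coefficients of T_j; the coefficient of T_n in degree n - 2i contributes a multiple
of (λ²/16)^i / i!, whence the exponential in λ². -/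

namespace WeightedPowerSeries

/-! ### Interpolation of monomials at Chebyshev nodes -/

open Polynomial Polynomial.Chebyshev

/-- The zeros of the Chebyshev polynomial `T n`. -/
noncomputable def chebyshevNode (n : ℕ) (k : Fin n) : ℝ :=
  Real.cos ((2 * (k : ℕ) + 1) * Real.pi / (2 * n))

lemma chebyshevNode_injective (n : ℕ) : Function.Injective (chebyshevNode n) := by
  have h := roots_T_real_nodup n
  have h2 := (Finset.range n).nodup_map_iff_injOn.mp h
  intro i j hij
  apply Fin.ext
  exact h2 (by simp) (by simp) hij

lemma eval_T_chebyshevNode (n : ℕ) (k : Fin n) : (T ℝ n).eval (chebyshevNode n k) = 0 := by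
  have hmem : chebyshevNode n k ∈ (T ℝ n).roots := by
    rw [roots_T_real]
    simp only [Finset.image_val, Multiset.mem_dedup, Multiset.mem_map]
    exact ⟨k, by simp, rfl⟩
  exact (mem_roots'.mp hmem).2

lemma chebyshevNode_mem (n : ℕ) (k : Fin n) : chebyshevNode n k ∈ Set.Icc (-1 : ℝ) 1 :=
  ⟨Real.neg_one_le_cos _, Real.cos_le_one _⟩

/-- The value at `x` of the polynomial of degree less than `n` interpolating `p` at the zeros of
`T n`. -/
noncomputable def chebyshevInterp (n : ℕ) (x : ℝ) (p : ℝ[X]) : ℝ :=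
  ∑ k : Fin n, p.eval (chebyshevNode n k) *
    (Lagrange.basis Finset.univ (chebyshevNode n) k).eval x

lemma chebyshevInterp_of_degree_lt {n : ℕ} (x : ℝ) {p : ℝ[X]} (hp : p.degree < n) :
    chebyshevInterp n x p = p.eval x := by
  have h := Lagrange.eq_interpolate (s := Finset.univ) (v := chebyshevNode n) (f := p)
    (chebyshevNode_injective n).injOn (by simpa using hp)
  conv_rhs => rw [h, Lagrange.interpolate_apply]
  simp [chebyshevInterp, eval_finsetSum]

lemma chebyshevInterp_T_self (n : ℕ) (x : ℝ) : chebyshevInterp n x (T ℝ n) = 0 := by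
  simp [chebyshevInterp, eval_T_chebyshevNode]

/-- Aliasing: T_j + T_{2n-j} = 2 T_n T_{j-n} vanishes at all nodes. -/
lemma chebyshevInterp_T_reflect (n : ℕ) (x : ℝ) (j : ℤ) :
    chebyshevInterp n x (T ℝ j) = -chebyshevInterp n x (T ℝ (2 * n - j)) := by
  simp only [chebyshevInterp]
  rw [← Finset.sum_neg_distrib]
  refine Finset.sum_congr rfl fun k _ => ?_
  have h := congrArg (eval (chebyshevNode n k)) (T_mul_T ℝ n (j - n))
  have e : (n : ℤ) - (j - n) = 2 * n - j := by ring
  simp only [eval_mul, eval_add, eval_T_chebyshevNode, mul_zero, zero_mul, e,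
    add_sub_cancel] at h
  rw [← neg_mul]
  congr 1
  linarith

/-- Repeated reflection lowers the index until it is n, where the interpolant is 0, or below n,
where it is T_j itself. -/
lemma abs_chebyshevInterp_T_le_one (n : ℕ) {x : ℝ} (hx : |x| ≤ 1) (j : ℕ) :
    |chebyshevInterp n x (T ℝ j)| ≤ 1 := by
  induction j using Nat.strong_induction_on with
  | _ j ih =>
    rcases lt_trichotomy j n with h | h | h
    · rw [chebyshevInterp_of_degree_lt _ (by simpa [degree_T] using h)]
      exact abs_eval_T_real_le_one _ hx
    · subst h
      simp [chebyshevInterp_T_self]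
    -- |2n - j| < j needs n > 0; for n = 0 the interpolant is an empty sum.
    · rcases Nat.eq_zero_or_pos n with rfl | hn
      · simp [chebyshevInterp]
      rw [chebyshevInterp_T_reflect, abs_neg, ← T_natAbs]
      exact ih _ (by omega)

lemma chebyshevInterp_add (n : ℕ) (x : ℝ) (p q : ℝ[X]) :
    chebyshevInterp n x (p + q) = chebyshevInterp n x p + chebyshevInterp n x q := by
  simp [chebyshevInterp, add_mul, Finset.sum_add_distrib]

lemma chebyshevInterp_C_mul (n : ℕ) (x c : ℝ) (p : ℝ[X]) :
    chebyshevInterp n x (C c * p) = c * chebyshevInterp n x p := by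
  simp [chebyshevInterp, Finset.mul_sum, mul_assoc]

lemma X_mul_T (j : ℤ) : X * T ℝ j = C (1 / 2) * (T ℝ (j + 1) + T ℝ (j - 1)) := by
  rw [T_add_one]
  have : (C (1 / 2 : ℝ)) * 2 = 1 := by
    rw [show (2 : ℝ[X]) = Polynomial.C 2 from rfl, ← Polynomial.C_mul]; norm_num
  linear_combination (-(X * T ℝ j)) * this

lemma eval_T_half_add_inv {r : ℝ} (hr : 0 < r) (j : ℕ) :
    (T ℝ j).eval ((r + r⁻¹) / 2) = (r ^ j + (r ^ j)⁻¹) / 2 := by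
  have h : (r + r⁻¹) / 2 = Real.cosh (Real.log r) := by
    rw [Real.cosh_eq, Real.exp_neg, Real.exp_log hr]
  rw [h, T_real_cosh, Real.cosh_eq, Real.exp_neg]
  simp [Real.exp_nat_mul, Real.exp_log hr]

lemma one_le_half_add_inv {r : ℝ} (hr : 0 < r) : 1 ≤ (r + r⁻¹) / 2 := by
  have h : r * r⁻¹ = 1 := mul_inv_cancel₀ hr.ne'
  have : 0 < r⁻¹ := inv_pos.mpr hr
  nlinarith [sq_nonneg (r - r⁻¹)]

/-- For |j| < n the error is 0. Otherwise it is at most 2, while T_j at (r + r⁻¹)/2 is at least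
rⁿ/2. -/
lemma abs_sub_chebyshevInterp_T_le (n : ℕ) {x : ℝ} (hx : |x| ≤ 1) {r : ℝ} (hr : 1 ≤ r) (j : ℤ) :
    |(T ℝ j).eval x - chebyshevInterp n x (T ℝ j)| ≤
      4 * (r ^ n)⁻¹ * (T ℝ j).eval ((r + r⁻¹) / 2) := by
  have hr0 : 0 < r := by linarith
  rw [← T_natAbs]
  generalize j.natAbs = m
  have h1 := one_le_eval_T_real m (one_le_half_add_inv hr0)
  rcases lt_or_ge m n with h | h
  · rw [chebyshevInterp_of_degree_lt _ (by simpa [degree_T] using h)]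
    simp only [sub_self, abs_zero]
    positivity
  · have h2 := abs_sub (T ℝ m |>.eval x) (chebyshevInterp n x (T ℝ m))
    have h3 := abs_eval_T_real_le_one m hx
    have h4 := abs_chebyshevInterp_T_le_one n hx m
    have h5 : r ^ n ≤ r ^ m := pow_le_pow_right₀ hr h
    rw [eval_T_half_add_inv hr0]
    have h6 : 0 < r ^ n := by positivity
    have h7 : 0 < (r ^ m)⁻¹ := by positivity
    have h8 : 1 ≤ (r ^ n)⁻¹ * r ^ m := by
      rw [inv_mul_eq_div, one_le_div h6]; exact h5
    have h9 : 0 < (r ^ n)⁻¹ * (r ^ m)⁻¹ := by positivity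
    nlinarith

/-- X T_j is the average of T_{j+1} and T_{j-1}, and averaging preserves the inequality. The index j
is a free integer so that the induction on k closes; only j = 0 is needed afterwards. -/
lemma abs_sub_chebyshevInterp_X_pow_mul_T_le (n : ℕ) {x : ℝ} (hx : |x| ≤ 1) {r : ℝ} (hr : 1 ≤ r)
    (k : ℕ) (j : ℤ) :
    |(X ^ k * T ℝ j).eval x - chebyshevInterp n x (X ^ k * T ℝ j)| ≤
      4 * (r ^ n)⁻¹ * (X ^ k * T ℝ j).eval ((r + r⁻¹) / 2) := by
  induction k generalizing j with
  | zero => simpa using abs_sub_chebyshevInterp_T_le n hx hr j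
  | succ k ih =>
    have e : X ^ (k + 1) * T ℝ j =
        C (1 / 2) * (X ^ k * T ℝ (j + 1) + X ^ k * T ℝ (j - 1)) := by
      rw [pow_succ, mul_assoc, X_mul_T]; ring
    rw [e, chebyshevInterp_C_mul, chebyshevInterp_add]
    have h1 := ih (j + 1)
    have h2 := ih (j - 1)
    generalize X ^ k * T ℝ (j + 1) = P at *
    generalize X ^ k * T ℝ (j - 1) = Q at *
    simp only [eval_mul, eval_add, eval_C]
    rw [abs_le] at *
    constructor <;> linarith [h1.1, h1.2, h2.1, h2.2]

/-- Interpolation error of monomials at the Chebyshev nodes, in terms of the Bernstein ellipse with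
parameter `r`. -/
lemma abs_pow_sub_chebyshevInterp_le (n : ℕ) {x : ℝ} (hx : |x| ≤ 1) {r : ℝ} (hr : 1 ≤ r) (k : ℕ) :
    |x ^ k - chebyshevInterp n x (X ^ k)| ≤ 4 * (r ^ n)⁻¹ * ((r + r⁻¹) / 2) ^ k := by
  simpa using abs_sub_chebyshevInterp_X_pow_mul_T_le n hx hr k 0

lemma chebyshevInterp_pow_of_lt {n k : ℕ} (x : ℝ) (hk : k < n) :
    chebyshevInterp n x (X ^ k) = x ^ k := by
  rw [chebyshevInterp_of_degree_lt _ (by simpa [degree_X_pow] using hk)]; simp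

end WeightedPowerSeries

/-! ### The error functional in the reproducing kernel Hilbert space -/

namespace WeightedPowerSeries

open RKHS
open scoped InnerProductSpace

/-- The error in the feature `φ x ^ k` of the approximation `A` at the point `x`. -/
noncomputable def featureError (φ : Dom → ℝ) {n : ℕ} (A : LinearApproximation n) (x : Dom) (k : ℕ) :
    ℝ :=
  φ x * (x : ℝ) ^ k - ∑ j, A.weight j x * (φ (A.node j) * (A.node j : ℝ) ^ k)

lemma hasSum_congr_terms {f g : ℕ → ℝ} {a : ℝ} (h : ∀ k, f k = g k) (hg : HasSum g a) :
    HasSum f a :=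
  (funext h : f = g) ▸ hg

lemma hasSum_kernel {φ : Dom → ℝ} {α : ℕ → ℝ} (hα_pos : ∀ k, 0 < α k)
    (hα_sum : Summable fun k => (α k)⁻¹) (x y : Dom) :
    HasSum (fun k => (α k)⁻¹ * (φ x * (x : ℝ) ^ k) * (φ y * (y : ℝ) ^ k)) (kernel φ α x y) := by
  have hs : Summable fun k : ℕ => (α k)⁻¹ * (x : ℝ) ^ k * (y : ℝ) ^ k := by
    refine Summable.of_norm_bounded hα_sum fun k => ?_
    have hx : |(x : ℝ)| ^ k ≤ 1 := pow_le_one₀ (abs_nonneg _) (abs_le.mpr x.2)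
    have hy : |(y : ℝ)| ^ k ≤ 1 := pow_le_one₀ (abs_nonneg _) (abs_le.mpr y.2)
    have ha : 0 < (α k)⁻¹ := inv_pos.mpr (hα_pos k)
    rw [Real.norm_eq_abs, abs_mul, abs_mul, abs_pow, abs_pow, abs_of_pos ha, mul_assoc]
    exact mul_le_of_le_one_right ha.le (mul_le_one₀ hx (by positivity) hy)
  exact hasSum_congr_terms (fun k => by ring) (hs.hasSum.mul_left (φ x * φ y))

variable {H : Type*} [NormedAddCommGroup H] [InnerProductSpace ℝ H] [CompleteSpace H]
  [RKHS ℝ H Dom ℝ]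

variable (H) in
/-- The representer of the error functional `f ↦ f x - (A f) x`. -/
noncomputable def errorRepresenter {n : ℕ} (A : LinearApproximation n) (x : Dom) : H :=
  kerFun H x 1 - ∑ j, A.weight j x • kerFun H (A.node j) 1

lemma inner_errorRepresenter {n : ℕ} (A : LinearApproximation n) (x : Dom) (f : H) :
    ⟪errorRepresenter H A x, f⟫_ℝ = f x - A.apply (fun y => f y) x := by
  simp only [errorRepresenter, inner_sub_left, sum_inner, inner_smul_left, kerFun_inner,
    LinearApproximation.apply]
  simp [mul_comm]

/-- The squared norm is the error functional applied to its own representer. Expanding the kernel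
and applying the functional in each variable produces one factor `featureError` each time, without
any orthonormal basis. -/
lemma hasSum_norm_errorRepresenter_sq {φ : Dom → ℝ} {α : ℕ → ℝ} (hα_pos : ∀ k, 0 < α k)
    (hα_sum : Summable fun k => (α k)⁻¹) (hH : IsRKHSOf H (kernel φ α)) {n : ℕ}
    (A : LinearApproximation n) (x : Dom) :
    HasSum (fun k => (α k)⁻¹ * featureError φ A x k ^ 2) (‖errorRepresenter H A x‖ ^ 2) := by
  have key : ∀ y : Dom, HasSum (fun k => (α k)⁻¹ * (φ y * (y : ℝ) ^ k) * featureError φ A x k)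
      (errorRepresenter H A x y) := by
    intro y
    have h1 : errorRepresenter H A x y =
        kernel φ α y x - ∑ j, A.weight j x * kernel φ α y (A.node j) := by
      rw [← hH y x, Finset.sum_congr rfl fun j _ => by rw [← hH y (A.node j)]]
      simp only [← kerFun_apply, ← coeCLM_apply, errorRepresenter, map_sub, map_sum, map_smul]
      simp
    rw [h1]
    refine hasSum_congr_terms (fun k => ?_) ((hasSum_kernel hα_pos hα_sum y x).sub
      (hasSum_sum fun j _ =>
        (hasSum_kernel hα_pos hα_sum y (A.node j)).mul_left (A.weight j x)))
    rw [featureError, mul_sub, Finset.mul_sum]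
    congr 1
    exact Finset.sum_congr rfl fun j _ => by ring
  have h2 : ‖errorRepresenter H A x‖ ^ 2 = errorRepresenter H A x x -
      ∑ j, A.weight j x * errorRepresenter H A x (A.node j) := by
    rw [← real_inner_self_eq_norm_sq, inner_errorRepresenter]
    simp [LinearApproximation.apply, mul_comm]
  rw [h2]
  refine hasSum_congr_terms (fun k => ?_) ((key x).sub
    (hasSum_sum fun j _ => (key (A.node j)).mul_left (A.weight j x)))
  have : ∑ j, A.weight j x * ((α k)⁻¹ * (φ (A.node j) * (A.node j : ℝ) ^ k) *
      featureError φ A x k) = (α k)⁻¹ * featureError φ A x k *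
        ∑ j, A.weight j x * (φ (A.node j) * (A.node j : ℝ) ^ k) := by
    rw [Finset.mul_sum]
    exact Finset.sum_congr rfl fun j _ => by ring
  rw [this]
  conv_lhs => rw [pow_two]
  nth_rewrite 2 [featureError]
  ring

lemma worstCaseError_le {n : ℕ} (A : LinearApproximation n) {B : ℝ}
    (h : ∀ x, ‖errorRepresenter H A x‖ ≤ B) : worstCaseError H A ≤ ENNReal.ofReal B := by
  refine iSup₂_le fun f hf => ?_
  have hf0 : 0 < ‖f‖ := norm_pos_iff.mpr hf
  refine ENNReal.div_le_of_le_mul ?_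
  have hB : 0 ≤ B := (norm_nonneg _).trans (h ⟨0, by norm_num⟩)
  rw [← ENNReal.ofReal_mul hB]
  refine iSup_le fun x => ENNReal.ofReal_le_ofReal ?_
  beta_reduce
  rw [← inner_errorRepresenter]
  exact (abs_real_inner_le_norm _ _).trans (by gcongr; exact h x)

lemma ofReal_norm_errorRepresenter_le {n : ℕ} (A : LinearApproximation n) (x : Dom) :
    ENNReal.ofReal ‖errorRepresenter H A x‖ ≤ worstCaseError H A := by
  by_cases h0 : errorRepresenter H A x = 0
  · simp [h0]
  -- The representer is itself the extremal test function.
  refine le_trans ?_ (le_iSup₂ (errorRepresenter H A x) h0)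
  have hp : 0 < ‖errorRepresenter H A x‖ := norm_pos_iff.mpr h0
  rw [ENNReal.le_div_iff_mul_le (by simp [h0]) (by simp), ← ENNReal.ofReal_mul hp.le]
  refine le_trans (ENNReal.ofReal_le_ofReal ?_) (le_iSup (fun y => ENNReal.ofReal
    |errorRepresenter H A x y - A.apply (fun y => errorRepresenter H A x y) y|) x)
  rw [← inner_errorRepresenter, real_inner_self_eq_norm_mul_norm]
  exact le_abs_self _

end WeightedPowerSeries

/-! ### Coefficients of Chebyshev polynomials -/

namespace WeightedPowerSeries

open Polynomial Polynomial.Chebyshev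
open scoped Nat

lemma coeff_T_nat_add_two (j k : ℕ) : (T ℝ ((j + 2 : ℕ) : ℤ)).coeff (k + 1) =
    2 * (T ℝ ((j + 1 : ℕ) : ℤ)).coeff k - (T ℝ (j : ℤ)).coeff (k + 1) := by
  push_cast
  rw [T_add_two, mul_assoc, coeff_sub, coeff_ofNat_mul, coeff_X_mul]

lemma coeff_zero_T_nat_add_two (j : ℕ) : (T ℝ ((j + 2 : ℕ) : ℤ)).coeff 0 =
    -(T ℝ (j : ℤ)).coeff 0 := by
  push_cast
  rw [T_add_two, mul_assoc, coeff_sub, coeff_ofNat_mul]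
  simp

lemma coeff_T_of_odd_add (j : ℕ) : ∀ k : ℕ, Odd (j + k) → (T ℝ (j : ℤ)).coeff k = 0 := by
  induction j using Nat.twoStepInduction with
  | zero =>
    intro k hk
    have : k ≠ 0 := by rintro rfl; simp at hk
    simp [coeff_one, this]
  | one =>
    intro k hk
    have : 1 ≠ k := by rintro rfl; exact absurd hk (by decide)
    simp [coeff_X, this]
  | more j ih1 ih2 =>
    intro k hk
    rcases k with _ | k
    · rw [coeff_zero_T_nat_add_two, ih1 0 (by grind), neg_zero]
    · rw [coeff_T_nat_add_two, ih1 (k + 1) (by grind), ih2 k (by grind)]; ring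

lemma coeff_T_of_lt {j k : ℕ} (h : j < k) : (T ℝ (j : ℤ)).coeff k = 0 :=
  coeff_eq_zero_of_natDegree_lt (by simpa [natDegree_T] using h)

lemma coeff_T_self (j : ℕ) : (T ℝ (j : ℤ)).coeff j = 2 ^ (j - 1) := by
  have h := leadingCoeff_T ℝ (j : ℤ)
  rwa [leadingCoeff, natDegree_T] at h

/-- The coefficients of the Chebyshev polynomials. -/
lemma coeff_T (s : ℕ) : ∀ m i : ℕ, m + 2 * i = s + 1 → (T ℝ ((s + 1 : ℕ) : ℤ)).coeff m =
    (-1) ^ i * (2 ^ m * (s + 1) * (m + i - 1)! / (2 * i ! * m !)) := by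
  induction s using Nat.strong_induction_on with
  | _ s ih =>
    intro m i hmi
    rcases i with _ | i
    · have hm : m = s + 1 := by omega
      subst hm
      rw [coeff_T_self]
      have : ((s + 1)! : ℝ) = (s + 1) * s ! := by push_cast [Nat.factorial_succ]; ring
      have h2 : (s ! : ℝ) ≠ 0 := by positivity
      have h3 : (s + 1 : ℝ) ≠ 0 := by positivity
      simp [this, pow_succ]
      field_simp
    · obtain ⟨s, rfl⟩ : ∃ t, s = t + 1 := ⟨s - 1, by omega⟩
      rcases m with _ | m
      · rw [coeff_zero_T_nat_add_two]
        rcases i with _ | i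
        · have : s = 0 := by omega
          subst this
          norm_num
        · obtain ⟨s, rfl⟩ : ∃ t, s = t + 1 := ⟨s - 1, by omega⟩
          rw [ih s (by omega) 0 (i + 1) (by omega)]
          have e1 : (s : ℝ) = 2 * i + 1 := by
            have : s = 2 * i + 1 := by omega
            exact_mod_cast this
          have h2 : (i ! : ℝ) ≠ 0 := by positivity
          simp only [zero_add, Nat.add_sub_cancel]
          push_cast [Nat.factorial_succ, e1]
          field_simp
          ring
      · rw [coeff_T_nat_add_two]
        rw [ih s (by omega) m (i + 1) (by omega)]
        obtain ⟨s, rfl⟩ : ∃ t, s = t + 1 := ⟨s - 1, by omega⟩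
        rw [ih s (by omega) (m + 1) i (by omega)]
        have e1 : (s : ℝ) = m + 2 * i := by
          have : s = m + 2 * i := by omega
          exact_mod_cast this
        have h2 : (i ! : ℝ) ≠ 0 := by positivity
        have h3 : (m ! : ℝ) ≠ 0 := by positivity
        have e2 : m + (i + 1) - 1 = m + i := by omega
        have e3 : m + 1 + i - 1 = m + i := by omega
        have e4 : m + 1 + (i + 1) - 1 = m + i + 1 := by omega
        rw [e2, e3, e4]
        push_cast [Nat.factorial_succ, e1]
        field_simp
        ring

/-- Log-convexity of the factorial. -/
lemma factorial_add_sq_le (a b : ℕ) : (a + b)! ^ 2 ≤ a ! * (a + 2 * b)! := by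
  induction b generalizing a with
  | zero => simp [pow_two]
  | succ b ih =>
    have h := ih (a + 1)
    have e1 : a + (b + 1) = a + 1 + b := by ring
    have e2 : a + 2 * (b + 1) = a + 1 + 2 * b + 1 := by ring
    rw [e1, e2, Nat.factorial_succ (a + 1 + 2 * b)]
    refine h.trans ?_
    rw [Nat.factorial_succ a]
    calc (a + 1) * a ! * (a + 1 + 2 * b)! ≤ (a + 1 + 2 * b + 1) * a ! * (a + 1 + 2 * b)! := by
          gcongr; omega
      _ = _ := by ring

/-! ### Weighted sums of squared coefficients -/

/-- The weights `λ^(n-k) k! / n!`. -/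
noncomputable def growthWeight (lam : ℝ) (n k : ℕ) : ℝ := lam ^ (n - k) * ((k ! : ℝ) / (n ! : ℝ))

lemma growthWeight_nonneg {lam : ℝ} (hlam : 0 ≤ lam) (n k : ℕ) : 0 ≤ growthWeight lam n k := by
  unfold growthWeight; positivity

lemma growthWeight_mul (lam : ℝ) {n j k : ℕ} (h1 : j ≤ n) (h2 : k ≤ j) :
    growthWeight lam n k = growthWeight lam n j * growthWeight lam j k := by
  unfold growthWeight
  have hj : (j ! : ℝ) ≠ 0 := by positivity
  have hn : (n ! : ℝ) ≠ 0 := by positivity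
  rw [show n - k = (n - j) + (j - k) by omega, pow_add]
  field_simp

/-- For i ≥ 1, log-convexity gives (m+i-1)!² ≤ m! (j-2)!, and j! = j (j-1) (j-2)! costs a factor
j/(j-1), which c absorbs. One i! of the two in the denominator survives, so that the sum over i is
an exponential series. -/
lemma growthWeight_mul_coeff_T_sq_le {lam : ℝ} {j m i : ℕ} (hj : j ≠ 0)
    (hmi : m + 2 * i = j) {c : ℝ} (hc1 : 1 ≤ c) (hc : 2 ≤ j → (j : ℝ) ≤ c * (j - 1)) :
    growthWeight lam j m * (T ℝ (j : ℤ)).coeff m ^ 2 ≤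
      4 ^ j / 4 * c * ((lam ^ 2 / 16) ^ i / i !) := by
  have key : (j : ℝ) ^ 2 * ((m + i - 1)! : ℝ) ^ 2 ≤ c * i ! * m ! * j ! := by
    rcases i with _ | i
    · have e : m = j := by omega
      subst e
      obtain ⟨m, rfl⟩ := Nat.exists_eq_succ_of_ne_zero hj
      simp only [Nat.add_zero, Nat.succ_eq_add_one, Nat.add_sub_cancel]
      rw [← mul_pow]
      have : (((m + 1 : ℕ) : ℝ) * (m ! : ℝ)) = ((m + 1)! : ℝ) := by
        push_cast [Nat.factorial_succ]; ring
      rw [this]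
      have h0 : (0 : ℝ) ≤ ((m + 1)! : ℝ) ^ 2 := by positivity
      simp only [Nat.factorial_zero, Nat.cast_one, mul_one]
      nlinarith
    · obtain ⟨t, rfl⟩ : ∃ t, j = t + 2 := ⟨j - 2, by omega⟩
      have ht : t = m + 2 * i := by omega
      have h1 : (((m + i)! : ℕ) : ℝ) ^ 2 ≤ m ! * t ! := by
        rw [ht]; exact_mod_cast factorial_add_sq_le m i
      have hc' := hc (by omega)
      have h2 : (1 : ℝ) ≤ ((i + 1)! : ℝ) := by exact_mod_cast Nat.factorial_pos (i + 1)
      rw [show m + (i + 1) - 1 = m + i by omega]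
      have e : ((t + 2)! : ℝ) = (t + 2) * (t + 1) * t ! := by
        push_cast [Nat.factorial_succ]; ring
      rw [e]
      push_cast at hc' ⊢
      have h3 : ((t : ℝ) + 2) * (t + 2) ≤ (c * (t + 1)) * (t + 2) := by
        gcongr; linarith
      calc ((t : ℝ) + 2) ^ 2 * ((m + i)! : ℝ) ^ 2
          ≤ ((c * (t + 1)) * (t + 2)) * (m ! * t !) := by
            rw [pow_two ((t : ℝ) + 2)]; gcongr
        _ ≤ ((c * (t + 1)) * (t + 2)) * (m ! * t !) * (i + 1)! :=
            le_mul_of_one_le_right (by positivity) h2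
        _ = _ := by ring
  obtain ⟨s, rfl⟩ := Nat.exists_eq_succ_of_ne_zero hj
  rw [Nat.succ_eq_add_one] at *
  rw [coeff_T s m i hmi, growthWeight, mul_pow, ← pow_mul, mul_comm i 2, pow_mul, neg_one_sq,
    one_pow, one_mul]
  have h2 : (i ! : ℝ) ≠ 0 := by positivity
  have h3 : (m ! : ℝ) ≠ 0 := by positivity
  have h4 : ((s + 1)! : ℝ) ≠ 0 := by positivity
  push_cast at key
  have e : lam ^ (s + 1 - m) * ((m ! : ℝ) / (s + 1)!) *
      (2 ^ m * (s + 1) * ((m + i - 1)! : ℝ) / (2 * i ! * m !)) ^ 2 =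
      4 ^ (s + 1) / 4 * ((lam ^ 2 / 16) ^ i / (i ! ^ 2 * m ! * (s + 1)!)) *
        ((s + 1 : ℝ) ^ 2 * ((m + i - 1)! : ℝ) ^ 2) := by
    rw [← hmi, show m + 2 * i - m = 2 * i by omega]
    have e1 : ((2 : ℝ) ^ m) ^ 2 = 4 ^ m := by rw [← pow_mul, mul_comm, pow_mul]; norm_num
    have e2 : (4 : ℝ) ^ (m + 2 * i) = 4 ^ m * 16 ^ i := by rw [pow_add, pow_mul]; norm_num
    rw [e2, div_pow, mul_pow, mul_pow, e1, div_pow (lam ^ 2), pow_mul lam]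
    rw [hmi]
    field_simp
    ring
  rw [e]
  have hx : 0 ≤ (lam ^ 2 / 16) ^ i / ((i ! : ℝ) ^ 2 * m ! * (s + 1)!) := by positivity
  calc _ ≤ 4 ^ (s + 1) / 4 * ((lam ^ 2 / 16) ^ i / ((i ! : ℝ) ^ 2 * m ! * (s + 1)!)) *
        (c * i ! * m ! * (s + 1)!) := by gcongr
    _ = _ := by field_simp

lemma sum_range_even_pow_div_factorial_le {x : ℝ} (hx : 0 ≤ x) (N : ℕ) :
    ∑ d ∈ Finset.range N, (if Even d then x ^ (d / 2) / (d / 2)! else 0) ≤ Real.exp x := by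
  have h1 : ∑ d ∈ Finset.range (2 * N), (if Even d then x ^ (d / 2) / ((d / 2)! : ℝ) else 0) =
      ∑ i ∈ Finset.range N, x ^ i / (i ! : ℝ) := by
    induction N with
    | zero => simp
    | succ N ih =>
      rw [show 2 * (N + 1) = 2 * N + 1 + 1 by ring, Finset.sum_range_succ, Finset.sum_range_succ,
        Finset.sum_range_succ, ih]
      have : ¬ Even (2 * N + 1) := by simp
      simp [this]
  refine le_trans ?_ (h1.trans_le (Real.sum_le_exp_of_nonneg hx N))
  refine Finset.sum_le_sum_of_subset_of_nonneg ?_ fun d _ _ => ?_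
  · intro d; simp only [Finset.mem_range]; omega
  · split_ifs <;> positivity

lemma sum_growthWeight_mul_coeff_T_sq_le (lam : ℝ) {j : ℕ} (hj : j ≠ 0)
    {c : ℝ} (hc1 : 1 ≤ c) (hc : 2 ≤ j → (j : ℝ) ≤ c * (j - 1)) :
    ∑ k ∈ Finset.range (j + 1), growthWeight lam j k * (T ℝ (j : ℤ)).coeff k ^ 2 ≤
      4 ^ j / 4 * c * Real.exp (lam ^ 2 / 16) := by
  rw [← Finset.sum_range_reflect]
  refine le_trans (Finset.sum_le_sum (g := fun d => 4 ^ j / 4 * c *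
    (if Even d then (lam ^ 2 / 16) ^ (d / 2) / (d / 2)! else 0)) fun d hd => ?_) ?_
  · have hd' : d ≤ j := Nat.lt_succ_iff.mp (Finset.mem_range.mp hd)
    rw [show j + 1 - 1 - d = j - d by omega]
    split_ifs with h
    · exact growthWeight_mul_coeff_T_sq_le hj (by have := Nat.two_mul_div_two_of_even h; omega)
        hc1 hc
    · rw [coeff_T_of_odd_add j (j - d) (by grind)]; simp
  · rw [← Finset.mul_sum]
    have h := sum_range_even_pow_div_factorial_le (x := lam ^ 2 / 16) (by positivity) (j + 1)
    gcongr

/-- `n^l (n-l)! ≤ 3^l n!`. -/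
lemma pow_mul_factorial_sub_le (n : ℕ) : ∀ l : ℕ, l ≤ n →
    (n : ℝ) ^ l * (n - l)! ≤ 3 ^ l * n ! := by
  induction n with
  | zero => intro l hl; obtain rfl : l = 0 := by omega
            simp
  | succ n ih =>
    intro l hl
    rcases l with _ | l
    · simp
    have hl' : l ≤ n := by omega
    have h1 := ih l hl'
    have h2 : ((n : ℝ) + 1) ^ l ≤ 3 * n ^ l := by
      rcases Nat.eq_zero_or_pos n with rfl | hn
      · obtain rfl : l = 0 := by omega
        norm_num
      have hn' : (0 : ℝ) < n := by exact_mod_cast hn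
      -- The base 3 of the lemma only has to exceed e.
      have h3 : (1 + 1 / (n : ℝ)) ^ l ≤ 3 := by
        have : (1 + 1 / (n : ℝ)) ^ l ≤ Real.exp 1 := by
          calc (1 + 1 / (n : ℝ)) ^ l ≤ (Real.exp (1 / n)) ^ l := by
                gcongr; linarith [Real.add_one_le_exp (1 / (n : ℝ))]
            _ = Real.exp (l * (1 / n)) := by rw [← Real.exp_nat_mul]
            _ ≤ Real.exp 1 := by
                gcongr
                rw [mul_one_div, div_le_one hn']; exact_mod_cast hl'
        linarith [Real.exp_one_lt_d9]
      calc ((n : ℝ) + 1) ^ l = (1 + 1 / (n : ℝ)) ^ l * n ^ l := by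
            rw [← mul_pow]; congr 1; field_simp
        _ ≤ _ := by gcongr
    rw [show n + 1 - (l + 1) = n - l by omega, Nat.factorial_succ]
    push_cast
    calc ((n : ℝ) + 1) ^ (l + 1) * (n - l)! = (n + 1) * (((n : ℝ) + 1) ^ l * (n - l)!) := by ring
      _ ≤ (n + 1) * ((3 * n ^ l) * (n - l)!) := by gcongr
      _ = (n + 1) * 3 * (n ^ l * (n - l)!) := by ring
      _ ≤ (n + 1) * 3 * (3 ^ l * n !) := by gcongr
      _ = _ := by ring

/-- Makes the contributions of T_j with j < n geometrically small relative to that of T_n. -/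
lemma growthWeight_mul_four_pow_le {lam : ℝ} (hlam : 0 ≤ lam) {n j : ℕ} (hn : n ≠ 0) (hj : j ≤ n) :
    growthWeight lam n j * 4 ^ j ≤ 4 ^ n * (3 * lam / (4 * n)) ^ (n - j) := by
  obtain ⟨l, rfl⟩ := Nat.exists_eq_add_of_le hj
  have h := pow_mul_factorial_sub_le (j + l) l (by omega)
  rw [Nat.add_sub_cancel] at h
  rw [growthWeight, Nat.add_sub_cancel_left]
  have hn' : (0 : ℝ) < ((j + l : ℕ) : ℝ) := by exact_mod_cast Nat.pos_of_ne_zero hn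
  generalize ((j + l : ℕ) : ℝ) = N at h hn'
  have h2 : (j ! : ℝ) / (j + l)! ≤ 3 ^ l / N ^ l := by
    rw [div_le_div_iff₀ (by positivity) (by positivity)]; linarith
  calc lam ^ l * ((j ! : ℝ) / (j + l)!) * 4 ^ j ≤ lam ^ l * (3 ^ l / N ^ l) * 4 ^ j := by gcongr
    _ = _ := by
      rw [div_pow, mul_pow, mul_pow, pow_add]
      field_simp

/-! ### Chebyshev expansions and coefficients versus sup norm -/

lemma exists_eq_sum_T (n : ℕ) : ∀ p : ℝ[X], p.natDegree ≤ n → ∃ a : ℕ → ℝ,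
    p = ∑ j ∈ Finset.range (n + 1), C (a j) * T ℝ (j : ℤ) := by
  induction n with
  | zero =>
    intro p hp
    exact ⟨fun _ => p.coeff 0, by simpa using eq_C_of_natDegree_le_zero hp⟩
  | succ n ih =>
    intro p hp
    set b := p.coeff (n + 1) / 2 ^ n with hb
    have hq : (p - C b * T ℝ ((n + 1 : ℕ) : ℤ)).natDegree ≤ n := by
      rw [natDegree_le_iff_coeff_eq_zero]
      intro N hN
      rw [coeff_sub, coeff_C_mul]
      rcases eq_or_lt_of_le (Nat.succ_le_iff.mpr hN) with h | h
      · rw [← h, Nat.succ_eq_add_one, coeff_T_self, Nat.add_sub_cancel, hb]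
        field_simp
        simp
      · rw [coeff_T_of_lt h, coeff_eq_zero_of_natDegree_lt (by omega)]; simp
    obtain ⟨a, ha⟩ := ih _ hq
    refine ⟨fun j => if j = n + 1 then b else a j, ?_⟩
    beta_reduce
    rw [Finset.sum_range_succ, if_pos rfl, ← sub_eq_iff_eq_add, ha]
    refine Finset.sum_congr rfl fun j hj => ?_
    rw [if_neg (by have := Finset.mem_range.mp hj; omega)]

open MeasureTheory in
/-- Bessel's inequality for Chebyshev expansions. -/
lemma sum_sq_le_of_abs_le {n : ℕ} {a : ℕ → ℝ} {p : ℝ[X]}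
    (hp : p = ∑ j ∈ Finset.range (n + 1), C (a j) * T ℝ (j : ℤ)) {M : ℝ}
    (hM : ∀ x ∈ Set.Icc (-1 : ℝ) 1, |p.eval x| ≤ M) :
    ∑ j ∈ Finset.range (n + 1), a j ^ 2 ≤ 2 * M ^ 2 := by
  have hint : ∀ f : ℝ → ℝ, Continuous f → Integrable f measureT :=
    fun f hf => integrable_measureT hf.continuousOn
  have h1 : ∫ x, (p.eval x) ^ 2 ∂measureT =
      ∑ j ∈ Finset.range (n + 1), a j ^ 2 * ∫ x, (T ℝ (j : ℤ)).eval x * (T ℝ (j : ℤ)).eval x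
        ∂measureT := by
    have e : ∀ x, (p.eval x) ^ 2 = ∑ i ∈ Finset.range (n + 1), ∑ j ∈ Finset.range (n + 1),
        (a i * a j) * ((T ℝ (i : ℤ)).eval x * (T ℝ (j : ℤ)).eval x) := by
      intro x
      rw [hp, eval_finsetSum, pow_two, Finset.sum_mul_sum]
      refine Finset.sum_congr rfl fun i _ => Finset.sum_congr rfl fun j _ => ?_
      simp only [eval_mul, eval_C]; ring
    simp_rw [e]
    rw [integral_finsetSum _ fun i _ => hint _ (by fun_prop)]
    refine Finset.sum_congr rfl fun i hi => ?_
    rw [integral_finsetSum _ fun i _ => hint _ (by fun_prop), Finset.sum_eq_single i]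
    · rw [integral_const_mul, pow_two]
    · intro j _ hji
      rw [integral_const_mul, integral_eval_T_real_mul_eval_T_real_measureT_of_ne hji.symm, mul_zero]
    · intro h; exact absurd hi h
  have h2 : ∑ j ∈ Finset.range (n + 1), a j ^ 2 * (Real.pi / 2) ≤
      ∫ x, (p.eval x) ^ 2 ∂measureT := by
    rw [h1]
    refine Finset.sum_le_sum fun j _ => ?_
    refine mul_le_mul_of_nonneg_left ?_ (sq_nonneg _)
    -- The squared norm of T_0 is π, that of the other T_j is π/2; the smaller value serves for all.
    rcases eq_or_ne j 0 with rfl | hj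
    · have := integral_eval_T_real_mul_self_measureT_zero
      push_cast
      rw [this]; linarith [Real.pi_pos]
    · rw [integral_T_real_mul_self_measureT_of_ne_zero hj]
  have h3 : ∫ x, (p.eval x) ^ 2 ∂measureT ≤ Real.pi * M ^ 2 := by
    rw [integral_measureT_eq_integral_cos]
    calc ∫ θ in (0 : ℝ)..Real.pi, (p.eval (Real.cos θ)) ^ 2
        ≤ ∫ _ in (0 : ℝ)..Real.pi, M ^ 2 := by
          refine intervalIntegral.integral_mono_on Real.pi_pos.le
            (Continuous.intervalIntegrable (by fun_prop) _ _) (by simp) fun θ _ => ?_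
          exact sq_le_sq' (abs_le.mp (hM _ ⟨Real.neg_one_le_cos θ, Real.cos_le_one θ⟩)).1
            (abs_le.mp (hM _ ⟨Real.neg_one_le_cos θ, Real.cos_le_one θ⟩)).2
      _ = _ := by simp
  rw [← Finset.sum_mul] at h2
  have := Real.pi_pos
  by_contra! hcon
  nlinarith

/-- Cauchy–Schwarz and Bessel replace p by the sum over all T_j, and the multiplicativity of the
weights splits off `growthWeight lam n j`. The term j = n needs a sharp constant; cruder bounds
suffice for the geometric tail. -/
lemma sum_growthWeight_mul_coeff_sq_le {lam : ℝ} (hlam : 0 < lam) {n : ℕ}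
    (h5 : 5 * lam ≤ n) (h9 : 9 / lam ≤ n) {p : ℝ[X]} (hp : p.natDegree ≤ n) {M : ℝ}
    (hM : ∀ x ∈ Set.Icc (-1 : ℝ) 1, |p.eval x| ≤ M) :
    ∑ k ∈ Finset.range (n + 1), growthWeight lam n k * p.coeff k ^ 2 ≤
      M ^ 2 * 4 ^ n * Real.exp (lam ^ 2 / 16) * ((1 + lam) / 2) := by
  obtain ⟨a, ha⟩ := exists_eq_sum_T n p hp
  have hB := sum_sq_le_of_abs_le ha hM
  have h9' : 9 ≤ n * lam := by rwa [div_le_iff₀ hlam] at h9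
  have hn45 : (45 : ℝ) ≤ n * n := by nlinarith
  have hn6 : (6 : ℝ) < n := by nlinarith
  have hn6' : 6 < n := by exact_mod_cast hn6
  have hn0 : n ≠ 0 := by omega
  set E := Real.exp (lam ^ 2 / 16) with hE
  have hE0 : 0 < E := Real.exp_pos _
  set S : ℕ → ℝ := fun j =>
    ∑ k ∈ Finset.range (j + 1), growthWeight lam j k * (T ℝ (j : ℤ)).coeff k ^ 2 with hS
  have hcoef : ∀ k, p.coeff k ^ 2 ≤
      2 * M ^ 2 * ∑ j ∈ Finset.range (n + 1), (T ℝ (j : ℤ)).coeff k ^ 2 := by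
    intro k
    have : p.coeff k = ∑ j ∈ Finset.range (n + 1), a j * (T ℝ (j : ℤ)).coeff k := by
      conv_lhs => rw [ha]
      simp
    rw [this]
    refine (Finset.sum_mul_sq_le_sq_mul_sq _ _ _).trans ?_
    gcongr
  have hstep : ∑ k ∈ Finset.range (n + 1), growthWeight lam n k * p.coeff k ^ 2 ≤
      2 * M ^ 2 * ∑ j ∈ Finset.range (n + 1), growthWeight lam n j * S j := by
    calc _ ≤ ∑ k ∈ Finset.range (n + 1), growthWeight lam n k *
          (2 * M ^ 2 * ∑ j ∈ Finset.range (n + 1), (T ℝ (j : ℤ)).coeff k ^ 2) :=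
          Finset.sum_le_sum fun k _ => mul_le_mul_of_nonneg_left (hcoef k)
            (growthWeight_nonneg hlam.le _ _)
      _ = 2 * M ^ 2 * ∑ j ∈ Finset.range (n + 1), ∑ k ∈ Finset.range (n + 1),
          growthWeight lam n k * (T ℝ (j : ℤ)).coeff k ^ 2 := by
          rw [Finset.sum_comm, Finset.mul_sum]
          refine Finset.sum_congr rfl fun k _ => ?_
          rw [Finset.mul_sum, Finset.mul_sum, Finset.mul_sum]
          exact Finset.sum_congr rfl fun j _ => by ring
      _ = _ := by
          congr 1
          refine Finset.sum_congr rfl fun j hj => ?_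
          have hj' : j ≤ n := Nat.lt_succ_iff.mp (Finset.mem_range.mp hj)
          rw [hS, Finset.mul_sum]
          symm
          have hsub : Finset.range (j + 1) ⊆ Finset.range (n + 1) := by
            intro k; simp only [Finset.mem_range]; omega
          rw [← Finset.sum_subset hsub]
          · refine Finset.sum_congr rfl fun k hk => ?_
            rw [growthWeight_mul lam hj' (Nat.lt_succ_iff.mp (Finset.mem_range.mp hk))]; ring
          · intro k _ hk
            rw [coeff_T_of_lt (by simpa using hk)]; simp
  have hSj : ∀ j, S j ≤ 4 ^ j * E := by
    intro j
    rcases eq_or_ne j 0 with rfl | hj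
    · simp only [hS]
      simp [growthWeight, hE]
      positivity
    · refine (sum_growthWeight_mul_coeff_T_sq_le lam hj (c := 2) (by norm_num) ?_).trans ?_
      · intro h
        have : (2 : ℝ) ≤ j := by exact_mod_cast h
        linarith
      · have : (0 : ℝ) < 4 ^ j * E := by positivity
        linarith
  -- From n ≥ 7 and nλ ≥ 9: (n-1) · 7λ/54 ≥ (6n/7) · 7λ/54 = nλ/9 ≥ 1.
  have hSn : S n ≤ 4 ^ n / 4 * (1 + 7 * lam / 54) * E := by
    refine sum_growthWeight_mul_coeff_T_sq_le lam hn0 (by linarith) fun _ => ?_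
    have hn7 : (7 : ℝ) ≤ n := by exact_mod_cast hn6'
    nlinarith
  set q := 3 * lam / (4 * n) with hq
  have hq0 : 0 ≤ q := by positivity
  have hq1 : q ≤ 3 / 20 := by
    rw [hq, div_le_div_iff₀ (by positivity) (by norm_num)]; linarith
  have hq2 : q ≤ 3 * lam / 28 := by
    have hn7 : (7 : ℝ) ≤ n := by exact_mod_cast hn6'
    rw [hq, div_le_div_iff₀ (by positivity) (by norm_num)]; nlinarith
  have hgeom : ∑ j ∈ Finset.range n, q ^ (n - j) ≤ q * (20 / 17) := by
    rw [← Finset.sum_range_reflect]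
    calc ∑ j ∈ Finset.range n, q ^ (n - (n - 1 - j)) = q * ∑ j ∈ Finset.range n, q ^ j := by
          rw [Finset.mul_sum]
          refine Finset.sum_congr rfl fun j hj => ?_
          have := Finset.mem_range.mp hj
          rw [show n - (n - 1 - j) = j + 1 by omega, pow_succ, mul_comm]
      _ ≤ q * (1 - q)⁻¹ := by
          gcongr
          have hs := summable_geometric_of_lt_one hq0 (by linarith)
          rw [← tsum_geometric_of_lt_one hq0 (by linarith)]
          exact hs.sum_le_tsum _ fun i _ => by positivity
      _ ≤ q * (20 / 17) := by
          gcongr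
          rw [inv_le_comm₀ (by linarith) (by norm_num)]; linarith
  have htot : ∑ j ∈ Finset.range (n + 1), growthWeight lam n j * S j ≤
      4 ^ n * E * ((1 + lam) / 4) := by
    rw [Finset.sum_range_succ]
    have hnn : growthWeight lam n n = 1 := by
      have : (n ! : ℝ) ≠ 0 := by positivity
      simp [growthWeight, this]
    have h1 : ∑ j ∈ Finset.range n, growthWeight lam n j * S j ≤ 4 ^ n * E * (q * (20 / 17)) := by
      calc _ ≤ ∑ j ∈ Finset.range n, 4 ^ n * E * q ^ (n - j) := by
            refine Finset.sum_le_sum fun j hj => ?_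
            have hg := growthWeight_mul_four_pow_le hlam.le hn0 (Finset.mem_range.mp hj).le
            calc growthWeight lam n j * S j ≤ growthWeight lam n j * (4 ^ j * E) :=
                  mul_le_mul_of_nonneg_left (hSj j) (growthWeight_nonneg hlam.le _ _)
              _ = growthWeight lam n j * 4 ^ j * E := by ring
              _ ≤ 4 ^ n * q ^ (n - j) * E := by gcongr
              _ = _ := by ring
        _ ≤ _ := by rw [← Finset.mul_sum]; gcongr
    rw [hnn, one_mul]
    have hP : (0 : ℝ) < 4 ^ n * E := by positivity
    have : q * (20 / 17) + (1 + 7 * lam / 54) / 4 ≤ (1 + lam) / 4 := by linarith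
    calc _ ≤ 4 ^ n * E * (q * (20 / 17)) + 4 ^ n / 4 * (1 + 7 * lam / 54) * E := add_le_add h1 hSn
      _ = 4 ^ n * E * (q * (20 / 17) + (1 + 7 * lam / 54) / 4) := by ring
      _ ≤ _ := by gcongr
  calc _ ≤ _ := hstep
    _ ≤ 2 * M ^ 2 * (4 ^ n * E * ((1 + lam) / 4)) := by gcongr
    _ = _ := by ring

end WeightedPowerSeries

/-! ### The upper bound -/

namespace WeightedPowerSeries

open Polynomial

lemma abs_le_phiMax {φ : Dom → ℝ} (hφ : PhiAssumption φ) (x : Dom) : |φ x| ≤ phiMax φ :=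
  le_ciSup hφ.2 x

lemma phiMin_le_abs (φ : Dom → ℝ) (x : Dom) : phiMin φ ≤ |φ x| :=
  ciInf_le ⟨0, by rintro _ ⟨y, rfl⟩; exact abs_nonneg _⟩ x

/-- Weighted polynomial interpolation at the Chebyshev nodes. -/
noncomputable def chebyshevApproximation {φ : Dom → ℝ} (hφ : LebesgueMeasurable φ) (n : ℕ) :
    LinearApproximation n where
  node k := ⟨chebyshevNode n k, chebyshevNode_mem n k⟩
  node_injective i j h := chebyshevNode_injective n (congrArg Subtype.val h)
  weight k x := φ x * ((φ ⟨chebyshevNode n k, chebyshevNode_mem n k⟩)⁻¹ *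
    (Lagrange.basis Finset.univ (chebyshevNode n) k).eval (x : ℝ))
  measurable_weight k := by
    have h : AEMeasurable φ lebesgue := MeasureTheory.NullMeasurable.aemeasurable hφ
    refine AEMeasurable.nullMeasurable (h.mul (Measurable.aemeasurable ?_))
    exact ((Polynomial.continuous _).measurable.comp measurable_subtype_coe).const_mul _

lemma featureError_chebyshevApproximation {φ : Dom → ℝ} (hφm : LebesgueMeasurable φ)
    (hφ : PhiAssumption φ) (n : ℕ) (x : Dom) (k : ℕ) :
    featureError φ (chebyshevApproximation hφm n) x k =
      φ x * ((x : ℝ) ^ k - chebyshevInterp n x (X ^ k)) := by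
  rw [featureError, chebyshevInterp, mul_sub, Finset.mul_sum]
  congr 1
  refine Finset.sum_congr rfl fun j _ => ?_
  have h0 : φ ⟨chebyshevNode n j, chebyshevNode_mem n j⟩ ≠ 0 :=
    abs_pos.mp (hφ.1.trans_le (phiMin_le_abs φ _))
  simp only [chebyshevApproximation, eval_pow, eval_X]
  field_simp

lemma inv_le_of_alphaAssumption {α : ℕ → ℝ} {lam : ℝ} (hα_pos : ∀ k, 0 < α k) (hlam : 0 < lam)
    (hα : AlphaAssumption α lam) {n : ℕ} (hn : 0 < n) (m : ℕ) :
    (α (m + n))⁻¹ ≤ (α n)⁻¹ * (lam / n) ^ m := by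
  have h := hα (m + n) n (by omega)
  have hn' : (0 : ℝ) < n := by exact_mod_cast hn
  rw [Nat.add_sub_cancel] at h
  have h1 : (n.factorial : ℝ) * (n : ℝ) ^ m ≤ (m + n).factorial := by
    have h2 : (n.factorial : ℝ) * ((n : ℝ) + 1) ^ m ≤ (m + n).factorial := by
      rw [add_comm m n]
      exact_mod_cast Nat.factorial_mul_pow_le_factorial (m := n) (n := m)
    refine le_trans ?_ h2
    gcongr
    linarith
  have h3 : (n.factorial : ℝ) / (m + n).factorial ≤ 1 / (n : ℝ) ^ m := by
    rw [div_le_div_iff₀ (by positivity) (by positivity)]; linarith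
  have h4 : α n / α (m + n) ≤ (lam / n) ^ m := by
    refine h.trans ?_
    rw [div_pow, div_eq_mul_one_div (lam ^ m)]
    gcongr
  rw [inv_mul_eq_div, le_div_iff₀ (hα_pos n), inv_mul_eq_div]
  exact h4

lemma sq_abs_pow_sub_chebyshevInterp_le {lam : ℝ} (hlam : 0 < lam) {n : ℕ} (hn : 0 < n)
    (h5 : 5 * lam ≤ n) {x : ℝ} (hx : |x| ≤ 1) (m : ℕ) :
    (lam / n) ^ m * (x ^ (m + n) - chebyshevInterp n x (X ^ (m + n))) ^ 2 ≤
      16 * Real.exp lam / 4 ^ n * (121 / 200) ^ m := by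
  have hn' : (0 : ℝ) < n := by exact_mod_cast hn
  -- With r² = R, each further degree contributes (λ/n)(R/4) = 1/2 up to (1 + R⁻¹)² ≤ (11/10)²,
  -- giving the ratio 121/200, while (1 + R⁻¹)^(2n) ≤ e^λ.
  set R : ℝ := 2 * n / lam with hR
  have hR0 : 0 < R := by positivity
  have hR10 : 10 ≤ R := by rw [hR, le_div_iff₀ hlam]; linarith
  set r := √R with hr
  have hr0 : 0 < r := Real.sqrt_pos.mpr hR0
  have hr2 : r ^ 2 = R := Real.sq_sqrt hR0.le
  have hr1 : 1 ≤ r := by rw [hr, Real.one_le_sqrt]; linarith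
  have h := abs_pow_sub_chebyshevInterp_le n hx hr1 (m + n)
  have hsq := pow_le_pow_left₀ (abs_nonneg _) h 2
  rw [sq_abs] at hsq
  have e : (4 * (r ^ n)⁻¹ * ((r + r⁻¹) / 2) ^ (m + n)) ^ 2 =
      16 / 4 ^ n * (R / 4) ^ m * ((1 + R⁻¹) ^ 2) ^ (m + n) := by
    have e1 : ((r + r⁻¹) / 2) ^ 2 = R / 4 * (1 + R⁻¹) ^ 2 := by
      rw [← hr2]; field_simp; ring
    rw [mul_pow, mul_pow, inv_pow, ← pow_mul, mul_comm n 2, pow_mul, hr2, ← pow_mul,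
      mul_comm (m + n) 2, pow_mul, e1, mul_pow (R / 4), pow_add (R / 4), div_pow R 4 n]
    field_simp
    norm_num
  rw [e] at hsq
  have hRi : R⁻¹ ≤ 1 / 10 := by
    rw [inv_le_comm₀ hR0 (by norm_num)]; linarith
  have hRi0 : 0 < R⁻¹ := inv_pos.mpr hR0
  have h2n : ((1 + R⁻¹) ^ 2) ^ n ≤ Real.exp lam := by
    rw [← pow_mul]
    calc (1 + R⁻¹) ^ (2 * n) ≤ (Real.exp R⁻¹) ^ (2 * n) := by
          gcongr; linarith [Real.add_one_le_exp R⁻¹]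
      _ = Real.exp ((2 * n : ℕ) * R⁻¹) := by rw [← Real.exp_nat_mul]
      _ = Real.exp lam := by
          congr 1; rw [hR]; push_cast; field_simp
  have hm : (1 + R⁻¹) ^ 2 ≤ 121 / 100 := by nlinarith
  calc _ ≤ (lam / n) ^ m * (16 / 4 ^ n * (R / 4) ^ m * ((1 + R⁻¹) ^ 2) ^ (m + n)) := by gcongr
    _ = 16 / 4 ^ n * ((1 + R⁻¹) ^ 2) ^ n * (1 / 2 * (1 + R⁻¹) ^ 2) ^ m := by
        have : (1 / 2 : ℝ) = lam / n * (R / 4) := by rw [hR]; field_simp; norm_num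
        rw [this, mul_pow, mul_pow, pow_add]; ring
    _ ≤ 16 / 4 ^ n * Real.exp lam * (1 / 2 * (121 / 100)) ^ m := by gcongr
    _ = _ := by norm_num; ring

/-- In terms of s = √(λn), the factor (λn)^(-1/4) is 1/√s, and the thresholds give s ≥ 3 and s ≥
11λ/5. Of e^{2s}, the part e^{43s/50} absorbs √s and the numerical constants; the remaining 57s/50
covers the exponent 5λ/2. -/
lemma cL_bound {lam : ℝ} (hlam : 0 < lam) {n : ℕ} (h5 : 5 * lam ≤ n) (h9 : 9 / lam ≤ n) :
    16 * Real.exp lam * (1 - 121 / 200 : ℝ)⁻¹ ≤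
      4 * cL lam * (n : ℝ) ^ (-(1 / 4) : ℝ) * Real.exp (2 * √(lam * n)) := by
  have h9' : 9 ≤ lam * n := by rw [div_le_iff₀ hlam] at h9; linarith
  have hn' : (0 : ℝ) < n := by linarith
  set s := √(lam * n) with hs
  have hs2 : s ^ 2 = lam * n := Real.sq_sqrt (by positivity)
  have hs0 : 0 ≤ s := Real.sqrt_nonneg _
  have hs3 : 3 ≤ s := by nlinarith
  have hsl : 11 / 5 * lam ≤ s := by
    refine le_of_pow_le_pow_left₀ two_ne_zero hs0 ?_
    nlinarith
  have hroot : lam ^ (1 / 4 : ℝ) * (n : ℝ) ^ (1 / 4 : ℝ) = √s := by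
    rw [← Real.mul_rpow hlam.le hn'.le, hs, Real.sqrt_eq_rpow, Real.sqrt_eq_rpow,
      ← Real.rpow_mul (by positivity)]
    norm_num
  set K := 3 + √(Real.pi / Real.exp 1) + 2 / (√Real.pi * lam ^ (1 / 4 : ℝ)) +
      7 / (16 * √lam) + √lam * (2 + lam) with hK
  have hl0 : 0 < √lam := Real.sqrt_pos.mpr hlam
  have hK58 : 29 / 5 ≤ K := by
    have k1 : 1 ≤ √(Real.pi / Real.exp 1) := by
      rw [Real.one_le_sqrt, one_le_div (Real.exp_pos _)]
      linarith [Real.exp_one_lt_d9, Real.pi_gt_three]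
    have k2 : 0 ≤ 2 / (√Real.pi * lam ^ (1 / 4 : ℝ)) := by positivity
    have k3 : 9 / 5 ≤ 7 / (16 * √lam) + 2 * √lam := by
      rw [← sub_nonneg]
      have : 7 / (16 * √lam) + 2 * √lam - 9 / 5 =
          (2 * (√lam - 9 / 20) ^ 2 + (7 / 16 - 81 / 200)) / √lam := by field_simp; ring
      rw [this]; positivity
    have k4 : 0 ≤ √lam * lam := by positivity
    rw [hK]; linarith
  have hpi : √Real.pi ≤ 7090 / 4000 := by
    rw [Real.sqrt_le_iff]; constructor
    · norm_num
    · linarith [Real.pi_lt_d4]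
  have hrhs : 4 * cL lam * (n : ℝ) ^ (-(1 / 4) : ℝ) * Real.exp (2 * s) =
      2 * K * Real.exp (-(3 / 2) * lam + 2 * √lam + 2 * s) / (√Real.pi * √s) := by
    rw [Real.rpow_neg hn'.le, ← hroot, Real.exp_add _ (2 * s), cL, ← hK]
    field_simp
    norm_num
  rw [hrhs, le_div_iff₀ (by positivity)]
  -- AM–GM at s = 3, with 173/50 just below 2√3.
  have hsq : √s ≤ (s + 3) / (173 / 50) := by
    rw [Real.sqrt_le_iff]; constructor
    · positivity
    · nlinarith [sq_nonneg (s - 3)]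
  have hexp : 31 / 5 * √s ≤ Real.exp (43 / 50 * s) := by
    have e2 : Real.exp (43 / 50 * s) = Real.exp 1 * Real.exp 1 * Real.exp (43 / 50 * s - 2) := by
      rw [← Real.exp_add, ← Real.exp_add]; congr 1; ring
    have e3 := Real.add_one_le_exp (43 / 50 * s - 2)
    have e4 : (7.38 : ℝ) ≤ Real.exp 1 * Real.exp 1 := by nlinarith [Real.exp_one_gt_d9]
    have e5 : (7.38 : ℝ) * (43 / 50 * s - 1) ≤ Real.exp (43 / 50 * s) := by
      rw [e2]; gcongr
      · linarith
      · linarith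
    linarith
  calc 16 * Real.exp lam * (1 - 121 / 200 : ℝ)⁻¹ * (√Real.pi * √s)
      ≤ 16 * Real.exp lam * (1 - 121 / 200 : ℝ)⁻¹ * (7090 / 4000 * √s) := by gcongr
    _ ≤ 58 / 5 * Real.exp lam * (31 / 5 * √s) := by
        have : 0 ≤ Real.exp lam * √s := by positivity
        norm_num
        linarith
    _ ≤ 58 / 5 * Real.exp lam * Real.exp (43 / 50 * s) := by gcongr
    _ = 2 * (29 / 5) * Real.exp (lam + 43 / 50 * s) := by rw [Real.exp_add]; ring
    _ ≤ 2 * K * Real.exp (-(3 / 2) * lam + 2 * √lam + 2 * s) := by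
        refine mul_le_mul (by linarith) (Real.exp_le_exp.mpr ?_) (Real.exp_nonneg _) (by linarith)
        linarith

variable {H : Type*} [NormedAddCommGroup H] [InnerProductSpace ℝ H] [CompleteSpace H]
  [RKHS ℝ H Dom ℝ]

lemma minimalError_le {φ : Dom → ℝ} {α : ℕ → ℝ} {lam : ℝ} (hφm : LebesgueMeasurable φ)
    (hφ : PhiAssumption φ) (hα_pos : ∀ k, 0 < α k) (hα_sum : Summable fun k => (α k)⁻¹)
    (hlam : 0 < lam) (hα : AlphaAssumption α lam) (hH : IsRKHSOf H (kernel φ α)) {n : ℕ}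
    (h5 : 5 * lam ≤ n) (h9 : 9 / lam ≤ n) :
    minimalError H n ≤ ENNReal.ofReal
        (c2 φ lam * (n : ℝ) ^ (-(1 / 8) : ℝ) * Real.exp (√(lam * (n : ℝ))) * (2 : ℝ) ^ (-(n : ℝ)) *
          (α n) ^ (-(1 / 2) : ℝ)) := by
  have hn' : (0 : ℝ) < n := by linarith
  have hn : 0 < n := by exact_mod_cast hn'
  have hmax : 0 ≤ phiMax φ := (abs_nonneg _).trans (abs_le_phiMax hφ ⟨0, by norm_num⟩)
  refine (iInf_le _ (chebyshevApproximation hφm n)).trans (worstCaseError_le _ fun x => ?_)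
  have hαn := hα_pos n
  have hcL : 0 ≤ cL lam := by unfold cL; positivity
  refine le_of_pow_le_pow_left₀ two_ne_zero (by unfold c2; positivity) ?_
  have hrhs : (c2 φ lam * (n : ℝ) ^ (-(1 / 8) : ℝ) * Real.exp (√(lam * (n : ℝ))) *
      (2 : ℝ) ^ (-(n : ℝ)) * (α n) ^ (-(1 / 2) : ℝ)) ^ 2 =
      phiMax φ ^ 2 * (α n)⁻¹ / 4 ^ n *
        (4 * cL lam * (n : ℝ) ^ (-(1 / 4) : ℝ) * Real.exp (2 * √(lam * n))) := by
    have e1 : ((n : ℝ) ^ (-(1 / 8) : ℝ)) ^ 2 = (n : ℝ) ^ (-(1 / 4) : ℝ) := by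
      rw [← Real.rpow_natCast, ← Real.rpow_mul hn'.le]; norm_num
    have e2 : ((2 : ℝ) ^ (-(n : ℝ))) ^ 2 = (4 ^ n)⁻¹ := by
      rw [Real.rpow_neg (by norm_num), Real.rpow_natCast, inv_pow, ← pow_mul, mul_comm, pow_mul]
      norm_num
    have e3 : ((α n) ^ (-(1 / 2) : ℝ)) ^ 2 = (α n)⁻¹ := by
      rw [← Real.rpow_natCast, ← Real.rpow_mul hαn.le, ← Real.rpow_neg_one]; norm_num
    have e4 : Real.exp (√(lam * (n : ℝ))) ^ 2 = Real.exp (2 * √(lam * n)) := by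
      rw [← Real.exp_nat_mul]; norm_num
    simp only [mul_pow, c2, e1, e2, e3, e4, Real.sq_sqrt hcL]
    ring
  rw [hrhs]
  refine le_trans ?_ (mul_le_mul_of_nonneg_left (cL_bound hlam h5 h9) (by positivity))
  have hS := hasSum_norm_errorRepresenter_sq hα_pos hα_sum hH (chebyshevApproximation hφm n) x
  -- The first n feature errors vanish, so the series starts at degree n.
  rw [← hasSum_nat_add_iff' n, Finset.sum_eq_zero, sub_zero] at hS
  · have hgeo := (hasSum_geometric_of_lt_one (r := (121 / 200 : ℝ)) (by norm_num)
      (by norm_num)).mul_left (phiMax φ ^ 2 * (α n)⁻¹ / 4 ^ n * (16 * Real.exp lam))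
    rw [mul_assoc (phiMax φ ^ 2 * (α n)⁻¹ / 4 ^ n)] at hgeo
    refine hasSum_le (fun m => ?_) hS hgeo
    rw [featureError_chebyshevApproximation hφm hφ, mul_pow]
    have h1 := inv_le_of_alphaAssumption hα_pos hlam hα hn m
    have h2 := sq_abs_pow_sub_chebyshevInterp_le hlam hn h5 (abs_le.mpr x.2) m
    have h3 : φ x ^ 2 ≤ phiMax φ ^ 2 := by
      rw [← sq_abs]; exact pow_le_pow_left₀ (abs_nonneg _) (abs_le_phiMax hφ x) 2
    calc (α (m + n))⁻¹ * (φ x ^ 2 * ((x : ℝ) ^ (m + n) - chebyshevInterp n x (X ^ (m + n))) ^ 2)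
        ≤ ((α n)⁻¹ * (lam / n) ^ m) * (phiMax φ ^ 2 *
          ((x : ℝ) ^ (m + n) - chebyshevInterp n x (X ^ (m + n))) ^ 2) := by gcongr
      _ = phiMax φ ^ 2 * (α n)⁻¹ * ((lam / n) ^ m *
          ((x : ℝ) ^ (m + n) - chebyshevInterp n x (X ^ (m + n))) ^ 2) := by ring
      _ ≤ phiMax φ ^ 2 * (α n)⁻¹ * (16 * Real.exp lam / 4 ^ n * (121 / 200) ^ m) := by gcongr
      _ = _ := by ring
  · intro k hk
    rw [featureError_chebyshevApproximation hφm hφ,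
      chebyshevInterp_pow_of_lt _ (Finset.mem_range.mp hk)]
    simp

/-! ### The lower bound -/

/-- A sees q only through its values at the nodes, which are 0, so the functions ψ_k drop out. -/
lemma sum_coeff_mul_featureError (φ : Dom → ℝ) {n : ℕ} (A : LinearApproximation n) (x : Dom)
    {q : ℝ[X]} (hq : q.natDegree ≤ n) (hroot : ∀ j, q.eval (A.node j : ℝ) = 0) :
    ∑ k ∈ Finset.range (n + 1), q.coeff k * featureError φ A x k = φ x * q.eval (x : ℝ) := by
  have hev : ∀ y : ℝ, ∑ k ∈ Finset.range (n + 1), q.coeff k * y ^ k = q.eval y := fun y =>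
    (eval_eq_sum_range' (Nat.lt_succ_of_le hq) y).symm
  simp only [featureError, mul_sub, Finset.sum_sub_distrib, Finset.mul_sum]
  rw [Finset.sum_comm]
  have h1 : ∀ j, ∑ k ∈ Finset.range (n + 1),
      q.coeff k * (A.weight j x * (φ (A.node j) * (A.node j : ℝ) ^ k)) = 0 := by
    intro j
    have := hroot j
    rw [← hev] at this
    rw [← mul_zero (A.weight j x * φ (A.node j)), ← this, Finset.mul_sum]
    exact Finset.sum_congr rfl fun k _ => by ring
  simp only [h1, Finset.sum_const_zero, sub_zero]
  rw [← hev, Finset.mul_sum]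
  exact Finset.sum_congr rfl fun k _ => by ring

lemma le_minimalError {φ : Dom → ℝ} {α : ℕ → ℝ} {lam : ℝ}
    (hφ : PhiAssumption φ) (hα_pos : ∀ k, 0 < α k) (hα_sum : Summable fun k => (α k)⁻¹)
    (hlam : 0 < lam) (hα : AlphaAssumption α lam) (hH : IsRKHSOf H (kernel φ α)) {n : ℕ}
    (h5 : 5 * lam ≤ n) (h9 : 9 / lam ≤ n) :
    ENNReal.ofReal (c1 φ lam * (2 : ℝ) ^ (-(n : ℝ)) * (α n) ^ (-(1 / 2) : ℝ)) ≤
      minimalError H n := by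
  refine le_iInf fun A => ?_
  set q : ℝ[X] := ∏ j : Fin n, (X - C (A.node j : ℝ)) with hq
  have hmonic : q.Monic := monic_prod_of_monic _ _ fun j _ => monic_X_sub_C _
  have hdeg : q.natDegree = n := by
    rw [hq, natDegree_prod_of_monic _ _ fun j _ => monic_X_sub_C _]; simp
  have hroot : ∀ j, q.eval (A.node j : ℝ) = 0 := by
    intro j
    rw [hq, eval_prod, Finset.prod_eq_zero (Finset.mem_univ j)]
    simp
  obtain ⟨x, hx, hxmax⟩ := isCompact_Icc.exists_isMaxOn (s := Set.Icc (-1 : ℝ) 1)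
    ⟨0, by norm_num⟩ (f := fun y => |q.eval y|) (by fun_prop)
  set M := |q.eval x| with hM
  have hsum := sum_growthWeight_mul_coeff_sq_le hlam h5 h9 hdeg.le (M := M) fun y hy => hxmax hy
  -- M = 0 would force the weighted coefficient sum to vanish, but its top term is 1 because q is
  -- monic.
  have hM0 : 0 < M := by
    rcases (abs_nonneg (q.eval x)).eq_or_lt with h | h
    · exfalso
      rw [hM, ← h, Finset.sum_range_succ] at hsum
      have hc : q.coeff n = 1 := by rw [← hdeg]; exact hmonic
      have hw : growthWeight lam n n = 1 := by
        have : (n.factorial : ℝ) ≠ 0 := by positivity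
        simp [growthWeight, this]
      have hnn : 0 ≤ ∑ k ∈ Finset.range n, growthWeight lam n k * q.coeff k ^ 2 :=
        Finset.sum_nonneg fun k _ => mul_nonneg (growthWeight_nonneg hlam.le _ _) (sq_nonneg _)
      rw [hc, hw] at hsum
      norm_num at hsum
      linarith
    · exact h
  refine le_trans (ENNReal.ofReal_le_ofReal ?_) (ofReal_norm_errorRepresenter_le A ⟨x, hx⟩)
  set g := errorRepresenter H A ⟨x, hx⟩
  have hS := hasSum_norm_errorRepresenter_sq hα_pos hα_sum hH A ⟨x, hx⟩
  have hαn := hα_pos n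
  have hpart : ∑ k ∈ Finset.range (n + 1), (α k)⁻¹ * featureError φ A ⟨x, hx⟩ k ^ 2 ≤ ‖g‖ ^ 2 :=
    sum_le_hasSum _ (fun k _ => mul_nonneg (inv_nonneg.mpr (hα_pos k).le) (sq_nonneg _)) hS
  have hcoef : ∑ k ∈ Finset.range (n + 1), α k * q.coeff k ^ 2 ≤
      α n * (M ^ 2 * 4 ^ n * Real.exp (lam ^ 2 / 16) * ((1 + lam) / 2)) := by
    refine le_trans ?_ (mul_le_mul_of_nonneg_left hsum hαn.le)
    rw [Finset.mul_sum]
    refine Finset.sum_le_sum fun k hk => ?_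
    have h := hα n k (Nat.lt_succ_iff.mp (Finset.mem_range.mp hk))
    rw [div_le_iff₀ hαn] at h
    rw [← mul_assoc, growthWeight, mul_comm (α n)]
    gcongr
  -- Cauchy–Schwarz with weights α_k and α_k⁻¹; M² later cancels against q(x)².
  have hCS : (φ ⟨x, hx⟩ * q.eval x) ^ 2 ≤
      (α n * (M ^ 2 * 4 ^ n * Real.exp (lam ^ 2 / 16) * ((1 + lam) / 2))) * ‖g‖ ^ 2 := by
    rw [← sum_coeff_mul_featureError φ A ⟨x, hx⟩ hdeg.le hroot]
    refine (Finset.sum_sq_le_sum_mul_sum_of_sq_le_mul _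
      (f := fun k => α k * q.coeff k ^ 2)
      (g := fun k => (α k)⁻¹ * featureError φ A ⟨x, hx⟩ k ^ 2) (fun k _ => ?_) (fun k _ => ?_)
      fun k _ => ?_).trans ?_
    · exact mul_nonneg (hα_pos k).le (sq_nonneg _)
    · exact mul_nonneg (inv_nonneg.mpr (hα_pos k).le) (sq_nonneg _)
    · have := (hα_pos k).ne'
      exact le_of_eq (by field_simp)
    · refine mul_le_mul hcoef hpart (Finset.sum_nonneg fun k _ =>
        mul_nonneg (inv_nonneg.mpr (hα_pos k).le) (sq_nonneg _)) (by positivity)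
  have hmin : phiMin φ ^ 2 ≤
      α n * 4 ^ n * Real.exp (lam ^ 2 / 16) * ((1 + lam) / 2) * ‖g‖ ^ 2 := by
    have h1 : phiMin φ ^ 2 * M ^ 2 ≤ (φ ⟨x, hx⟩ * q.eval x) ^ 2 := by
      rw [← mul_pow, ← sq_abs (φ _ * _), abs_mul]
      have := hφ.1.le
      gcongr
      exact phiMin_le_abs φ _
    have hM2 : 0 < M ^ 2 := by positivity
    refine le_of_mul_le_mul_right ((h1.trans hCS).trans_eq ?_) hM2
    ring
  refine le_of_pow_le_pow_left₀ two_ne_zero (norm_nonneg _) ?_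
  have e2 : ((2 : ℝ) ^ (-(n : ℝ))) ^ 2 = (4 ^ n)⁻¹ := by
    rw [Real.rpow_neg (by norm_num), Real.rpow_natCast, inv_pow, ← pow_mul, mul_comm, pow_mul]
    norm_num
  have e3 : ((α n) ^ (-(1 / 2) : ℝ)) ^ 2 = (α n)⁻¹ := by
    rw [← Real.rpow_natCast, ← Real.rpow_mul hαn.le, ← Real.rpow_neg_one]; norm_num
  have e4 : Real.exp (-(1 / 32) * lam ^ 2) ^ 2 = (Real.exp (lam ^ 2 / 16))⁻¹ := by
    rw [← Real.exp_nat_mul, ← Real.exp_neg]; congr 1; push_cast; ring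
  simp only [mul_pow, c1, e2, e3, e4]
  rw [Real.sq_sqrt (by positivity)]
  have hE := Real.exp_pos (lam ^ 2 / 16)
  calc _ ≤ 2 / (1 + lam) * (Real.exp (lam ^ 2 / 16))⁻¹ *
        (α n * 4 ^ n * Real.exp (lam ^ 2 / 16) * ((1 + lam) / 2) * ‖g‖ ^ 2) * (4 ^ n)⁻¹ *
        (α n)⁻¹ := by gcongr
    _ = _ := by field_simp

end WeightedPowerSeries

theorem theorem3p4
    (φ : WeightedPowerSeries.Dom → ℝ) (α : ℕ → ℝ) (lam : ℝ)
    (hφ_meas : WeightedPowerSeries.LebesgueMeasurable φ)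
    (hφ : WeightedPowerSeries.PhiAssumption φ)
    (hα_pos : ∀ k, 0 < α k) (hα_sum : Summable fun k => (α k)⁻¹)
    (hlam : 0 < lam) (hα : WeightedPowerSeries.AlphaAssumption α lam)
    (H : Type*) [NormedAddCommGroup H] [InnerProductSpace ℝ H] [CompleteSpace H]
    [RKHS ℝ H WeightedPowerSeries.Dom ℝ]
    (hH : WeightedPowerSeries.IsRKHSOf H (WeightedPowerSeries.kernel φ α))
    (n : ℕ) (hn : WeightedPowerSeries.mL lam ≤ (n : ℝ)) :
    ENNReal.ofReal
        (WeightedPowerSeries.c1 φ lam * (2 : ℝ) ^ (-(n : ℝ)) * (α n) ^ (-(1 / 2) : ℝ))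
      ≤ WeightedPowerSeries.minimalError H n ∧
    WeightedPowerSeries.minimalError H n ≤
      ENNReal.ofReal
        (WeightedPowerSeries.c2 φ lam * (n : ℝ) ^ (-(1 / 8) : ℝ) *
          Real.exp (Real.sqrt (lam * (n : ℝ))) * (2 : ℝ) ^ (-(n : ℝ)) *
          (α n) ^ (-(1 / 2) : ℝ)) := by
  have h5 : 5 * lam ≤ n := (le_max_left _ _).trans hn
  have h9 : 9 / lam ≤ n := ((le_max_right _ _).trans (le_max_right _ _)).trans hn
  exact ⟨WeightedPowerSeries.le_minimalError hφ hα_pos hα_sum hlam hα hH h5 h9,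
    WeightedPowerSeries.minimalError_le hφ_meas hφ hα_pos hα_sum hlam hα hH h5 h9⟩
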